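/- For a group $G$, the $Z^\pm$-power graph $\mathcal G^\pm(G)$ is the simple graph with vertex set $G$ in which two distinct elements $x,y$ are adjacent if and only if there is an integer $n\neq 0$ with $y=x^n$ or $x=y^n$; the power graph $\mathcal G(G)$ is defined in the same way, with $n$ ranging over all integers. Let $(\mathbb Q,+)$ be the additive group of the rational numbers (so that powers are integer multiples). Let $G$ be any group. If $\mathcal G^\pm(G)\cong\mathcal G^\pm(\mathbb Q)$ as graphs, then $G\cong(\mathbb Q,+)$ as groups. Likewise, if $\mathcal G(G)\cong\mathcal G(\mathbb Q)$ as graphs, then $G\cong(\mathbb Q,+)$ as groups. Thus $(\mathbb Q,+)$ is determined up to isomorphism, among all groups, by its $Z^\pm$-power graph and also by its power graph. -/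

import Mathlib

/-- The `Z^±`-power graph of a group: distinct `x` and `y` are adjacent if one of them is a power
of the other with a nonzero integer exponent. -/
def zpmPowerGraph (G : Type*) [Group G] : SimpleGraph G where
  Adj x y := x ≠ y ∧ ∃ n : ℤ, n ≠ 0 ∧ (y = x ^ n ∨ x = y ^ n)
  symm := ⟨fun _ _ ⟨hne, n, hn, h⟩ => ⟨hne.symm, n, hn, h.symm⟩⟩
  loopless := ⟨fun _ h => h.1 rfl⟩

/-- The power graph of a group: distinct `x` and `y` are adjacent if one of them is a power
of the other with an arbitrary integer exponent. -/
def powerGraph (G : Type*) [Group G] : SimpleGraph G where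
  Adj x y := x ≠ y ∧ ∃ n : ℤ, y = x ^ n ∨ x = y ^ n
  symm := ⟨fun _ _ ⟨hne, n, h⟩ => ⟨hne.symm, n, h.symm⟩⟩
  loopless := ⟨fun _ h => h.1 rfl⟩

/-!
A graph isomorphism, read as a bijection `f : ℚ ≃ G`, sends `0` to `1`: in the power graph of `ℚ`
only `0` is adjacent to all other vertices, and in the `Z^±`-power graph the neighbours of `1` are
the torsion elements, so that `1` is adjacent to its whole connected component, which fails for
every nonzero rational. On the remaining vertices both graphs are the comparability graph of
"is a power of", so both statements reduce to one about such a bijection (`PreservesComparability`).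

The comparability graph of the nonzero rationals under divisibility has only two transitive
orientations, namely divisibility and its reverse. Indeed, if `m` and `n` are coprime nonunits, then
`m * a` and `n * a` are incomparable, so transitivity in `G` forces the edges from `a` to `m * a`
and to `n * a` to point in the same way, and likewise the edges from `m * c` and `n * c` to
`m * n * c`. These forcings link all edges (`PreservesComparability.up_const`). Since `a ↦ a⁻¹`
reverses divisibility, `f` may be replaced by `a ↦ f a⁻¹` if necessary, and then
`f b` is a power of `f a` exactly when `b` is an integer multiple of `a` (`PreservesPowers`).

Under such a bijection `G` is locally cyclic and torsion-free. It is also divisible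
(`PreservesPowers.exists_prime_root`): for a prime `p`, the element `(f a) ^ p` is `f (m * a)` with
`m` irreducible, and since between `a / m` and `m * a` there is only `a`, the element `f a` is a
power of `z ^ p`, where `z = f (a / m)`. A nontrivial locally cyclic, torsion-free, divisible group
is isomorphic to `ℚ` (`nonempty_mulEquiv_rat`).
-/

/-! ### Locally cyclic, torsion-free, divisible groups -/

section Divisible

variable {G : Type*} [Group G]

theorem mul_comm_of_locally_cyclic
    (hcyc : ∀ x y : G, ∃ w, x ∈ Subgroup.zpowers w ∧ y ∈ Subgroup.zpowers w) (x y : G) :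
    x * y = y * x := by
  obtain ⟨w, ⟨i, rfl⟩, ⟨j, rfl⟩⟩ := hcyc x y
  exact (Commute.refl w).zpow_zpow i j

/-- Roots are unique in a commutative torsion-free group. -/
theorem eq_of_zpow_eq_zpow (hcomm : ∀ x y : G, x * y = y * x)
    (htf : ∀ (x : G) (n : ℤ), x ^ n = 1 → n = 0 ∨ x = 1)
    {x y : G} {n : ℤ} (hn : n ≠ 0) (h : x ^ n = y ^ n) : x = y := by
  have hc : Commute x y⁻¹ := hcomm _ _
  have h1 : (x * y⁻¹) ^ n = 1 := by
    rw [hc.mul_zpow, h, inv_zpow, mul_inv_cancel]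
  exact mul_inv_eq_one.mp ((htf _ _ h1).resolve_left hn)

theorem nonempty_mulEquiv_rat
    (hcyc : ∀ x y : G, ∃ w, x ∈ Subgroup.zpowers w ∧ y ∈ Subgroup.zpowers w)
    (htf : ∀ (x : G) (n : ℤ), x ^ n = 1 → n = 0 ∨ x = 1)
    (hdiv : ∀ (x : G) (n : ℕ), n ≠ 0 → ∃ z, z ^ n = x)
    (hnt : ∃ x : G, x ≠ 1) : Nonempty (G ≃* Multiplicative ℚ) := by
  have hcomm := mul_comm_of_locally_cyclic hcyc
  obtain ⟨x, hx⟩ := hnt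
  -- `E r` is the element `x ^ r`, the unique root of `x ^ r.num` of order `r.den`.
  choose E hE using fun r : ℚ => hdiv (x ^ r.num) r.den r.den_nz
  simp only [← zpow_natCast] at hE
  have huniq : ∀ (g : G) (r : ℚ) (m n : ℤ), m ≠ 0 → g ^ m = x ^ n → r * m = n → g = E r := by
    intro g r m n hm hg hr
    have hd : (r.den : ℤ) ≠ 0 := by exact_mod_cast r.den_nz
    refine eq_of_zpow_eq_zpow hcomm htf (mul_ne_zero hm hd) ?_
    have h1 : n * r.den = r.num * m := by
      have h2 : r * r.den = r.num := Rat.mul_den_eq_num r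
      have : (n : ℚ) * r.den = r.num * m := by rw [← hr, ← h2]; ring
      exact_mod_cast this
    rw [zpow_mul, hg, ← zpow_mul, h1, mul_comm m, zpow_mul (E r), hE, ← zpow_mul]
  let φ : Multiplicative ℚ →* G := MonoidHom.mk' (fun r => E r.toAdd) (by
    intro r s
    set r' := r.toAdd with hr'
    set s' := s.toAdd with hs'
    have hrd : (r'.den : ℤ) ≠ 0 := by exact_mod_cast r'.den_nz
    have hsd : (s'.den : ℤ) ≠ 0 := by exact_mod_cast s'.den_nz
    symm
    refine huniq _ (r * s).toAdd (r'.den * s'.den) (r'.num * s'.den + s'.num * r'.den)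
      (mul_ne_zero hrd hsd) ?_ ?_
    · have hc : Commute (E r') (E s') := hcomm _ _
      rw [hc.mul_zpow, zpow_mul, hE, mul_comm (r'.den : ℤ), zpow_mul (E s'), hE, ← zpow_mul,
        ← zpow_mul, ← zpow_add]
    · rw [toAdd_mul, ← hr', ← hs']
      push_cast
      rw [← Rat.mul_den_eq_num r', ← Rat.mul_den_eq_num s']
      ring)
  refine ⟨(MulEquiv.ofBijective φ ⟨?_, ?_⟩).symm⟩
  · rw [injective_iff_map_eq_one]
    intro r hr
    have hr1 : E r.toAdd = 1 := hr
    have h := hE r.toAdd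
    rw [hr1, one_zpow] at h
    have h0 := (htf _ _ h.symm).resolve_right hx
    exact Rat.num_eq_zero.mp h0
  · intro g
    obtain ⟨w, ⟨i, hi⟩, ⟨j, hj⟩⟩ := hcyc g x
    simp only at hi hj
    have hj0 : j ≠ 0 := by
      rintro rfl
      exact hx (by rw [← hj, zpow_zero])
    refine ⟨Multiplicative.ofAdd ((i : ℚ) / j), (huniq g _ j i hj0 ?_ ?_).symm⟩
    · rw [← hi, ← hj, ← zpow_mul, ← zpow_mul, mul_comm]
    · have : (j : ℚ) ≠ 0 := by exact_mod_cast hj0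
      simp [this]

end Divisible

/-! ### Bijections preserving the directed power relation -/

/-- The bijection `f` is an isomorphism of directed power graphs: `f b` is a power of `f a` if and
only if `b` is an integer multiple of `a`. -/
def PreservesPowers {G : Type*} [Group G] (f : ℚ ≃ G) : Prop :=
  ∀ a b : ℚ, f b ∈ Subgroup.zpowers (f a) ↔ ∃ n : ℤ, b = n * a

namespace PreservesPowers

variable {G : Type*} [Group G] {f : ℚ ≃ G}

theorem map_zero (hf : PreservesPowers f) : f 0 = 1 := by
  obtain ⟨b, hb⟩ := f.surjective 1
  obtain ⟨n, hn⟩ := (hf 0 b).1 (hb ▸ Subgroup.one_mem _)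
  rw [mul_zero] at hn
  rw [← hn, hb]

theorem exists_common_generator (hf : PreservesPowers f) (x y : G) :
    ∃ w, x ∈ Subgroup.zpowers w ∧ y ∈ Subgroup.zpowers w := by
  obtain ⟨a, rfl⟩ := f.surjective x
  obtain ⟨b, rfl⟩ := f.surjective y
  have ha : (a.den : ℚ) ≠ 0 := by exact_mod_cast a.den_nz
  have hb : (b.den : ℚ) ≠ 0 := by exact_mod_cast b.den_nz
  refine ⟨f (1 / (a.den * b.den)), (hf _ _).2 ⟨a.num * b.den, ?_⟩, (hf _ _).2 ⟨b.num * a.den, ?_⟩⟩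
  · push_cast
    rw [← Rat.mul_den_eq_num a]
    field_simp
  · push_cast
    rw [← Rat.mul_den_eq_num b]
    field_simp

theorem eq_zero_or_eq_one_of_zpow_eq_one (hf : PreservesPowers f) (x : G) (n : ℤ) (h : x ^ n = 1) :
    n = 0 ∨ x = 1 := by
  by_contra! hne
  obtain ⟨a, rfl⟩ := f.surjective x
  have ha : a ≠ 0 := by
    rintro rfl
    exact hne.2 hf.map_zero
  have hfin : IsOfFinOrder (f a) := isOfFinOrder_iff_zpow_eq_one.2 ⟨n, hne.1, h⟩
  have hfin' : (Subgroup.zpowers (f a) : Set G).Finite := finite_zpowers.2 hfin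
  -- The cyclic group generated by `f a` contains the distinct elements `f (k * a)`.
  refine Set.infinite_of_injective_forall_mem (f := fun k : ℤ => f (k * a)) ?_
    (fun k => (hf _ _).2 ⟨k, rfl⟩) hfin'
  intro k l hkl
  exact_mod_cast mul_right_cancel₀ ha (f.injective hkl)

theorem zpow_injective (hf : PreservesPowers f) {x : G} (hx : x ≠ 1) {m n : ℤ}
    (h : x ^ m = x ^ n) : m = n := by
  have : x ^ (m - n) = 1 := by rw [zpow_sub, h, mul_inv_cancel]
  have := (hf.eq_zero_or_eq_one_of_zpow_eq_one _ _ this).resolve_right hx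
  omega

theorem isUnit_of_mem_zpowers_zpow (hf : PreservesPowers f) {x : G} (hx : x ≠ 1) {n : ℤ}
    (h : x ∈ Subgroup.zpowers (x ^ n)) : IsUnit n := by
  obtain ⟨k, hk⟩ := h
  simp only [← zpow_mul] at hk
  exact IsUnit.of_mul_eq_one k (hf.zpow_injective hx (hk.trans (zpow_one x).symm))

theorem isUnit_of_mem_zpowers_mul (hf : PreservesPowers f) {a : ℚ} (ha : a ≠ 0) {n : ℤ}
    (h : f a ∈ Subgroup.zpowers (f (n * a))) : IsUnit n := by
  obtain ⟨k, hk⟩ := (hf _ _).1 h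
  have h1 : (1 : ℚ) * a = (n * k : ℤ) * a := by push_cast; linarith
  have h2 : (1 : ℤ) = n * k := by exact_mod_cast mul_right_cancel₀ ha h1
  exact IsUnit.of_mul_eq_one k h2.symm

/-- No cyclic subgroup of `G` lies strictly between those of `f a` and `f a ^ p`, so no rational lies
strictly between the corresponding ones in the divisibility order. -/
theorem exists_irreducible (hf : PreservesPowers f) {a : ℚ} (ha : a ≠ 0) {p : ℤ}
    (hp : Prime p) : ∃ m : ℤ, Irreducible m ∧ f (m * a) = f a ^ p := by
  have hx : f a ≠ 1 := fun h => ha (f.injective (h.trans hf.map_zero.symm))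
  obtain ⟨b, hb⟩ := f.surjective (f a ^ p)
  obtain ⟨m, rfl⟩ := (hf a b).1 (hb ▸ Subgroup.zpow_mem_zpowers _ _)
  refine ⟨m, ⟨?_, ?_⟩, hb⟩
  · rintro hm
    obtain ⟨k, hk⟩ := hm.exists_right_inv
    refine hp.not_isUnit (hf.isUnit_of_mem_zpowers_zpow hx (hb ▸ (hf _ _).2 ⟨k, ?_⟩))
    have : (m : ℚ) * k = 1 := by exact_mod_cast hk
    linear_combination (-a) * this
  · rintro i j rfl
    obtain ⟨s, hs⟩ := (hf a (i * a)).2 ⟨i, rfl⟩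
    obtain ⟨t, ht⟩ := (hf (i * a) ((i * j : ℤ) * a)).2 ⟨j, by push_cast; ring⟩
    simp only at hs ht
    have hi0 : (i : ℚ) * a ≠ 0 := by
      intro h
      have h0 : ((i * j : ℤ) : ℚ) * a = 0 := by push_cast; linear_combination (j : ℚ) * h
      rw [h0, hf.map_zero] at hb
      exact hx ((hf.eq_zero_or_eq_one_of_zpow_eq_one _ _ hb.symm).resolve_left hp.ne_zero)
    have hst : p = s * t :=
      hf.zpow_injective hx (by rw [← hb, ← ht, ← hs, zpow_mul])
    rcases hp.irreducible.isUnit_or_isUnit hst with h | h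
    · left
      apply hf.isUnit_of_mem_zpowers_mul ha
      obtain ⟨k, hk⟩ := h.exists_right_inv
      exact ⟨k, by simp only [← hs, ← zpow_mul, hk, zpow_one]⟩
    · right
      apply hf.isUnit_of_mem_zpowers_mul hi0
      obtain ⟨k, hk⟩ := h.exists_right_inv
      have : (j : ℚ) * (i * a) = (i * j : ℤ) * a := by push_cast; ring
      exact ⟨k, by simp only [this, ← ht, ← zpow_mul, hk, zpow_one]⟩

theorem exists_prime_root (hf : PreservesPowers f) (x : G) {p : ℤ} (hp : Prime p) :
    ∃ z, z ^ p = x := by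
  obtain ⟨a, rfl⟩ := f.surjective x
  by_cases ha : a = 0
  · exact ⟨1, by rw [ha, hf.map_zero, one_zpow]⟩
  obtain ⟨m, hm, hma⟩ := hf.exists_irreducible ha hp
  have hm0 : (m : ℚ) ≠ 0 := by exact_mod_cast hm.ne_zero
  have hz0 : a / m ≠ 0 := div_ne_zero ha hm0
  have hz : f (a / m) ≠ 1 := fun h => hz0 (f.injective (h.trans hf.map_zero.symm))
  obtain ⟨k, hk⟩ := (hf (a / m) a).2 ⟨m, by field_simp⟩
  obtain ⟨c, hc⟩ := f.surjective (f (a / m) ^ p)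
  obtain ⟨j, rfl⟩ := (hf (a / m) c).1 (hc ▸ Subgroup.zpow_mem_zpowers _ _)
  -- With `z = f (a / m)` and `z ^ p = f (j * (a / m))`, the element `(f a) ^ p = f (m * a)` is a
  -- power of `z ^ p`, so `j` divides `m ^ 2` and is associated to `1`, `m` or `m ^ 2`.
  obtain ⟨i, hi⟩ := (hf (j * (a / m)) (m * a)).1
    ⟨k, by simp only at hk ⊢; rw [hc, hma, ← hk, ← zpow_mul, ← zpow_mul, mul_comm]⟩
  have hij : m ^ 2 = i * j := by
    have : (m : ℚ) ^ 2 * a = (i * j) * a := by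
      field_simp at hi
      linear_combination a * hi
    exact_mod_cast mul_right_cancel₀ ha this
  obtain ⟨e, he, hje⟩ := (dvd_prime_pow hm.prime 2).1 (Dvd.intro_left i hij.symm)
  obtain ⟨u, hu⟩ := hje
  have hu' : (j : ℚ) * (u : ℤ) = m ^ e := by exact_mod_cast hu
  interval_cases e
  · -- `z ^ p` would generate the same subgroup as `z`.
    exfalso
    refine hp.not_isUnit (hf.isUnit_of_mem_zpowers_zpow hz (hc ▸ (hf _ _).2 ⟨u, ?_⟩))
    linear_combination (-(a / m)) * hu'
  · obtain ⟨l, hl⟩ := (hf (j * (a / m)) a).2 ⟨u, by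
      have : a = m ^ 1 * (a / m) := by field_simp
      linear_combination this - (a / m) * hu'⟩
    exact ⟨f (a / m) ^ l, by
      simp only [hc, ← zpow_mul] at hl
      rw [← zpow_mul, mul_comm, hl]⟩
  · -- `z ^ p` would generate the same subgroup as `(f a) ^ p`, and so `z` the same one as `f a`.
    exfalso
    obtain ⟨v, hv⟩ := u.isUnit.exists_right_inv
    have hv' : ((u : ℤ) : ℚ) * v = 1 := by exact_mod_cast hv
    obtain ⟨l, hl⟩ := (hf (m * a) (j * (a / m))).2 ⟨v, by
      have : m * a = m ^ 2 * (a / m) := by field_simp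
      rw [this, ← hu']
      linear_combination (-(j * (a / m))) * hv'⟩
    have hzx : f a ^ l = f (a / m) := by
      refine eq_of_zpow_eq_zpow (mul_comm_of_locally_cyclic hf.exists_common_generator)
        hf.eq_zero_or_eq_one_of_zpow_eq_one hp.ne_zero ?_
      simp only [hma, hc] at hl
      rw [← hl, ← zpow_mul, ← zpow_mul, mul_comm]
    refine hm.not_isUnit (hf.isUnit_of_mem_zpowers_mul hz0 ⟨l, ?_⟩)
    have : (m : ℚ) * (a / m) = a := by field_simp
    simp only [this, hzx]

theorem exists_root (hf : PreservesPowers f) (n : ℕ) (hn : n ≠ 0) (x : G) :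
    ∃ z, z ^ n = x := by
  induction n using induction_on_primes generalizing x with
  | zero => exact absurd rfl hn
  | one => exact ⟨x, pow_one x⟩
  | prime_mul p n hp ih =>
    obtain ⟨y, hy⟩ := hf.exists_prime_root x (Nat.prime_iff_prime_int.1 hp)
    obtain ⟨z, hz⟩ := ih (right_ne_zero_of_mul hn) y
    exact ⟨z, by rw [mul_comm, pow_mul, hz, ← hy, zpow_natCast]⟩

theorem nonempty_mulEquiv (hf : PreservesPowers f) : Nonempty (G ≃* Multiplicative ℚ) :=
  nonempty_mulEquiv_rat hf.exists_common_generator hf.eq_zero_or_eq_one_of_zpow_eq_one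
    (fun x n hn => hf.exists_root n hn x)
    ⟨f 1, fun h => one_ne_zero (f.injective (h.trans hf.map_zero.symm))⟩

end PreservesPowers

/-! ### Comparability of rational numbers under divisibility -/

/-- One of the two rational numbers is an integer multiple of the other. -/
def RatComparable (a b : ℚ) : Prop := ∃ n : ℤ, b = n * a ∨ a = n * b

theorem ratComparable_mul (a : ℚ) (n : ℤ) : RatComparable a (n * a) := ⟨n, Or.inl rfl⟩

theorem RatComparable.inv {a b : ℚ} (ha : a ≠ 0) (hb : b ≠ 0) (h : RatComparable a b) :
    RatComparable a⁻¹ b⁻¹ := by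
  obtain ⟨n, rfl | rfl⟩ := h
  · have := left_ne_zero_of_mul hb
    exact ⟨n, Or.inr (by field_simp)⟩
  · have := left_ne_zero_of_mul ha
    exact ⟨n, Or.inl (by field_simp)⟩

theorem not_ratComparable_of_isCoprime {a : ℚ} (ha : a ≠ 0) {m n : ℤ} (h : IsCoprime m n)
    (hm : ¬IsUnit m) (hn : ¬IsUnit n) : ¬RatComparable (m * a) (n * a) := by
  rintro ⟨k, hk | hk⟩
  · have h1 : (n : ℚ) * a = (k * m) * a := by linear_combination hk
    have h2 : n = k * m := by exact_mod_cast mul_right_cancel₀ ha h1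
    exact hm (h.isUnit_of_dvd' dvd_rfl (Dvd.intro_left k h2.symm))
  · have h1 : (m : ℚ) * a = (k * n) * a := by linear_combination hk
    have h2 : m = k * n := by exact_mod_cast mul_right_cancel₀ ha h1
    exact hn (h.isUnit_of_dvd' (Dvd.intro_left k h2.symm) dvd_rfl)

theorem not_ratComparable_two_thirds {a : ℚ} (ha : a ≠ 0) : ¬RatComparable a (2 * a / 3) := by
  have h := not_ratComparable_of_isCoprime (a := a / 3) (div_ne_zero ha three_ne_zero)
    (m := 3) (n := 2) ⟨1, -1, by norm_num⟩ (by decide) (by decide)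
  have h1 : ((3 : ℤ) : ℚ) * (a / 3) = a := by push_cast; ring
  have h2 : ((2 : ℤ) : ℚ) * (a / 3) = 2 * a / 3 := by push_cast; ring
  rwa [h1, h2] at h

theorem exists_isCoprime_isCoprime {m n : ℤ} (hm : m ≠ 0) (hn : n ≠ 0) :
    ∃ p : ℤ, p ≠ 0 ∧ ¬IsUnit p ∧ IsCoprime p m ∧ IsCoprime p n := by
  obtain ⟨p, hp, hpp⟩ := Nat.exists_infinite_primes (m.natAbs + n.natAbs + 1)
  have hpi := Nat.prime_iff_prime_int.1 hpp
  refine ⟨p, hpi.ne_zero, hpi.not_isUnit, ?_, ?_⟩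
  · refine (Prime.coprime_iff_not_dvd hpi).2 fun h => ?_
    have := Nat.le_of_dvd (Int.natAbs_pos.2 hm) (Int.natCast_dvd.1 h)
    omega
  · refine (Prime.coprime_iff_not_dvd hpi).2 fun h => ?_
    have := Nat.le_of_dvd (Int.natAbs_pos.2 hn) (Int.natCast_dvd.1 h)
    omega

/-! ### Orienting the comparability graph -/

/-- The bijection `f` sends `0` to `1`, and on the other vertices it is an isomorphism of power
graphs. -/
structure PreservesComparability {G : Type*} [Group G] (f : ℚ ≃ G) : Prop where
  map_zero : f 0 = 1
  comparable_iff : ∀ a b : ℚ, a ≠ 0 → b ≠ 0 →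
    ((f b ∈ Subgroup.zpowers (f a) ∨ f a ∈ Subgroup.zpowers (f b)) ↔ RatComparable a b)

namespace PreservesComparability

variable {G : Type*} [Group G] {f : ℚ ≃ G}

theorem comp_inv (hf : PreservesComparability f) :
    PreservesComparability ((Equiv.inv ℚ).trans f) where
  map_zero := by simpa using hf.map_zero
  comparable_iff a b ha hb := by
    simp only [Equiv.trans_apply, Equiv.inv_apply]
    rw [hf.comparable_iff _ _ (inv_ne_zero ha) (inv_ne_zero hb)]
    refine ⟨fun h => ?_, fun h => h.inv ha hb⟩
    simpa using h.inv (inv_ne_zero ha) (inv_ne_zero hb)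

/-- Otherwise `f (m * a)` would be a power of `f a`, and that of `f (n * a)`, making `m * a` and
`n * a` comparable. -/
theorem up_of_isCoprime (hf : PreservesComparability f) {a : ℚ} (ha : a ≠ 0) {m n : ℤ}
    (hm0 : m ≠ 0) (hn0 : n ≠ 0) (hm : ¬IsUnit m) (hn : ¬IsUnit n) (hmn : IsCoprime m n)
    (h : f (m * a) ∈ Subgroup.zpowers (f a)) : f (n * a) ∈ Subgroup.zpowers (f a) := by
  have hma : (m : ℚ) * a ≠ 0 := mul_ne_zero (by exact_mod_cast hm0) ha
  have hna : (n : ℚ) * a ≠ 0 := mul_ne_zero (by exact_mod_cast hn0) ha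
  refine ((hf.comparable_iff a (n * a) ha hna).2 (ratComparable_mul a n)).resolve_right fun h' => ?_
  exact not_ratComparable_of_isCoprime ha hmn hm hn ((hf.comparable_iff _ _ hma hna).1
    (Or.inr (Subgroup.zpowers_le.2 h' h)))

theorem up (hf : PreservesComparability f) {a : ℚ} (ha : a ≠ 0) {m n : ℤ}
    (hm0 : m ≠ 0) (hn0 : n ≠ 0) (hm : ¬IsUnit m) (hn : ¬IsUnit n)
    (h : f (m * a) ∈ Subgroup.zpowers (f a)) : f (n * a) ∈ Subgroup.zpowers (f a) := by
  obtain ⟨p, hp0, hp, hpm, hpn⟩ := exists_isCoprime_isCoprime hm0 hn0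
  exact hf.up_of_isCoprime ha hp0 hn0 hp hn hpn (hf.up_of_isCoprime ha hm0 hp0 hm hp hpm.symm h)

/-- The edges from `n * c` and `m * c` to their common multiple `m * n * c` point in the same
way. -/
theorem up_transfer (hf : PreservesComparability f) {c : ℚ} (hc : c ≠ 0) {m n : ℤ}
    (hm0 : m ≠ 0) (hn0 : n ≠ 0) (hm : ¬IsUnit m) (hn : ¬IsUnit n) (hmn : IsCoprime m n)
    (h : f ((2 : ℤ) * (n * c)) ∈ Subgroup.zpowers (f (n * c))) :
    f ((2 : ℤ) * (m * c)) ∈ Subgroup.zpowers (f (m * c)) := by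
  have hmc : (m : ℚ) * c ≠ 0 := mul_ne_zero (by exact_mod_cast hm0) hc
  have hnc : (n : ℚ) * c ≠ 0 := mul_ne_zero (by exact_mod_cast hn0) hc
  have hnmc : (n : ℚ) * (m * c) ≠ 0 := mul_ne_zero (by exact_mod_cast hn0) hmc
  have h1 := hf.up hnc two_ne_zero hm0 (by decide) hm h
  rw [mul_left_comm] at h1
  refine hf.up hmc hn0 two_ne_zero hn (by decide) ?_
  refine ((hf.comparable_iff _ _ hmc hnmc).2 (ratComparable_mul _ n)).resolve_right fun h' => ?_
  exact not_ratComparable_of_isCoprime hc hmn hm hn ((hf.comparable_iff _ _ hmc hnc).1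
    (Or.inr (Subgroup.zpowers_le.2 h1 h')))

/-- The orientation of the edge from `a` to `2 * a` does not depend on `a`. -/
theorem up_const (hf : PreservesComparability f) {a b : ℚ} (ha : a ≠ 0) (hb : b ≠ 0)
    (h : f ((2 : ℤ) * a) ∈ Subgroup.zpowers (f a)) :
    f ((2 : ℤ) * b) ∈ Subgroup.zpowers (f b) := by
  -- The factor `2` in the denominator makes the two multipliers nonunits.
  set c : ℚ := 1 / (2 * a.den * b.den) with hc
  have had : (a.den : ℚ) ≠ 0 := by exact_mod_cast a.den_nz
  have hbd : (b.den : ℚ) ≠ 0 := by exact_mod_cast b.den_nz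
  have hc0 : c ≠ 0 := by positivity
  obtain ⟨m, hm0, hm, hac⟩ : ∃ m : ℤ, m ≠ 0 ∧ ¬IsUnit m ∧ a = m * c := by
    refine ⟨2 * (a.num * b.den), ?_, ?_, ?_⟩
    · have := Rat.num_ne_zero.2 ha
      have := b.den_nz
      positivity
    · exact fun h => absurd (isUnit_of_mul_isUnit_left h) (by decide)
    · push_cast
      rw [← Rat.mul_den_eq_num a, hc]
      field_simp
  obtain ⟨n, hn0, hn, hbc⟩ : ∃ n : ℤ, n ≠ 0 ∧ ¬IsUnit n ∧ b = n * c := by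
    refine ⟨2 * (b.num * a.den), ?_, ?_, ?_⟩
    · have := Rat.num_ne_zero.2 hb
      have := a.den_nz
      positivity
    · exact fun h => absurd (isUnit_of_mul_isUnit_left h) (by decide)
    · push_cast
      rw [← Rat.mul_den_eq_num b, hc]
      field_simp
  obtain ⟨p, hp0, hp, hpm, hpn⟩ := exists_isCoprime_isCoprime hm0 hn0
  rw [hac] at h
  rw [hbc]
  exact hf.up_transfer hc0 hn0 hp0 hn hp hpn.symm (hf.up_transfer hc0 hp0 hm0 hp hm hpm h)

/-- Elements generating the same cyclic subgroup of `G` have the same neighbours, and vertices of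
`ℚ` with the same neighbours agree up to sign. -/
theorem isUnit_of_mem_of_mem (hf : PreservesComparability f) {a : ℚ} (ha : a ≠ 0) {n : ℤ}
    (hn0 : n ≠ 0) (h1 : f (n * a) ∈ Subgroup.zpowers (f a))
    (h2 : f a ∈ Subgroup.zpowers (f (n * a))) : IsUnit n := by
  by_contra hn
  obtain ⟨p, hp0, hp, hpn, -⟩ := exists_isCoprime_isCoprime hn0 hn0
  have hna : (n : ℚ) * a ≠ 0 := mul_ne_zero (by exact_mod_cast hn0) ha
  have hpa : (p : ℚ) * a ≠ 0 := mul_ne_zero (by exact_mod_cast hp0) ha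
  refine not_ratComparable_of_isCoprime ha hpn.symm hn hp ((hf.comparable_iff _ _ hna hpa).1 ?_)
  rcases (hf.comparable_iff _ _ ha hpa).2 (ratComparable_mul a p) with h | h
  · exact Or.inl (Subgroup.zpowers_le.2 h2 h)
  · exact Or.inr (Subgroup.zpowers_le.2 h h1)

theorem preservesPowers (hf : PreservesComparability f)
    (hup : ∀ a : ℚ, a ≠ 0 → f ((2 : ℤ) * a) ∈ Subgroup.zpowers (f a)) : PreservesPowers f := by
  have hne : ∀ a : ℚ, a ≠ 0 → f a ≠ 1 := fun a ha h => ha (f.injective (h.trans hf.map_zero.symm))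
  have hnonunit : ∀ (a : ℚ) (n : ℤ), a ≠ 0 → n ≠ 0 → ¬IsUnit n →
      f (n * a) ∈ Subgroup.zpowers (f a) :=
    fun a n ha hn0 hn => hf.up ha two_ne_zero hn0 (by decide) hn (hup a ha)
  have hneg : ∀ a : ℚ, f (-a) = (f a)⁻¹ := by
    intro a
    by_cases ha : a = 0
    · rw [ha, neg_zero, hf.map_zero, inv_one]
    obtain ⟨b, hb⟩ := f.surjective (f a)⁻¹
    have hb0 : b ≠ 0 := by
      rintro rfl
      rw [hf.map_zero] at hb
      exact hne a ha (inv_eq_one.1 hb.symm)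
    have hab : f a ∈ Subgroup.zpowers (f b) := by
      rw [hb, Subgroup.zpowers_inv]
      exact Subgroup.mem_zpowers _
    have hba : f b ∈ Subgroup.zpowers (f a) := by
      rw [hb]
      exact inv_mem (Subgroup.mem_zpowers _)
    have hor : b = a ∨ b = -a := by
      obtain ⟨n, hn | hn⟩ := (hf.comparable_iff a b ha hb0).1 (Or.inl hba)
      · subst hn
        have hn0 : n ≠ 0 := by
          rintro rfl
          simp at hb0
        rcases Int.isUnit_iff.1 (hf.isUnit_of_mem_of_mem ha hn0 hba hab) with rfl | rfl <;> simp
      · subst hn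
        have hn0 : n ≠ 0 := by
          rintro rfl
          simp at ha
        rcases Int.isUnit_iff.1 (hf.isUnit_of_mem_of_mem hb0 hn0 hab hba) with rfl | rfl <;> simp
    rcases hor with rfl | rfl
    · -- An element `f b` of order two has too few powers to account for all `f (n * b)`.
      exfalso
      have hfin : IsOfFinOrder (f b) := isOfFinOrder_iff_zpow_eq_one.2
        ⟨2, two_ne_zero, by rw [zpow_two]; nth_rewrite 1 [hb]; exact inv_mul_cancel _⟩
      have hfin' : (Subgroup.zpowers (f b) : Set G).Finite := finite_zpowers.2 hfin
      refine Set.infinite_of_injective_forall_mem (f := fun k : ℕ => f (((k + 2 : ℕ) : ℤ) * b)) ?_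
        (fun k => hnonunit b _ ha (by omega) ?_) hfin'
      · intro k l hkl
        have := mul_right_cancel₀ ha (f.injective hkl)
        have h2 : k + 2 = l + 2 := by exact_mod_cast this
        omega
      · rw [Int.isUnit_iff]
        omega
    · exact hb
  have hall : ∀ (a : ℚ) (n : ℤ), f (n * a) ∈ Subgroup.zpowers (f a) := by
    intro a n
    by_cases ha : a = 0
    · rw [ha, mul_zero]
      exact Subgroup.mem_zpowers _
    by_cases hn0 : n = 0
    · rw [hn0, Int.cast_zero, zero_mul, hf.map_zero]
      exact one_mem _
    by_cases hn : IsUnit n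
    · rcases Int.isUnit_iff.1 hn with rfl | rfl
      · simp
      · simp [hneg]
    · exact hnonunit a n ha hn0 hn
  intro a b
  refine ⟨fun h => ?_, ?_⟩
  · by_cases hb : b = 0
    · exact ⟨0, by simp [hb]⟩
    by_cases ha : a = 0
    · exfalso
      rw [ha, hf.map_zero, Subgroup.zpowers_one_eq_bot, Subgroup.mem_bot] at h
      exact hne b hb h
    obtain ⟨n, hn | rfl⟩ := (hf.comparable_iff a b ha hb).1 (Or.inl h)
    · exact ⟨n, hn⟩
    · have hn0 : n ≠ 0 := by
        rintro rfl
        simp at ha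
      obtain ⟨k, hk⟩ := (hf.isUnit_of_mem_of_mem hb hn0 (hall b n) h).exists_right_inv
      have hk' : (n : ℚ) * k = 1 := by exact_mod_cast hk
      exact ⟨k, by linear_combination (-b) * hk'⟩
  · rintro ⟨n, rfl⟩
    exact hall a n

theorem nonempty_mulEquiv (hf : PreservesComparability f) :
    Nonempty (G ≃* Multiplicative ℚ) := by
  by_cases h : f ((2 : ℤ) * 1) ∈ Subgroup.zpowers (f 1)
  · exact (hf.preservesPowers fun a ha => hf.up_const one_ne_zero ha h).nonempty_mulEquiv
  · refine (hf.comp_inv.preservesPowers fun a ha => ?_).nonempty_mulEquiv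
    -- All edges of `ℚ` are reversed by `f`, so inversion of `ℚ` reverses them back.
    set b : ℚ := ((2 : ℤ) * a)⁻¹ with hb
    have hb0 : b ≠ 0 := by
      rw [hb]
      exact inv_ne_zero (mul_ne_zero (by norm_num) ha)
    have hab : a⁻¹ = (2 : ℤ) * b := by
      rw [hb]
      push_cast
      field_simp
    simp only [Equiv.trans_apply, Equiv.inv_apply]
    rw [← hb, hab]
    exact ((hf.comparable_iff b _ hb0 (hab ▸ inv_ne_zero ha)).2
      (ratComparable_mul b 2)).resolve_left fun h' => h (hf.up_const hb0 one_ne_zero h')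

end PreservesComparability

/-! ### From graph isomorphisms to comparability -/

section Graphs

variable {G : Type*} [Group G]

theorem zpmPowerGraph_adj_iff {x y : G} (hx : x ≠ 1) (hy : y ≠ 1) :
    (zpmPowerGraph G).Adj x y ↔
      x ≠ y ∧ (y ∈ Subgroup.zpowers x ∨ x ∈ Subgroup.zpowers y) := by
  refine and_congr_right fun _ => ⟨?_, ?_⟩
  · rintro ⟨n, -, h | h⟩
    · exact Or.inl ⟨n, h.symm⟩
    · exact Or.inr ⟨n, h.symm⟩
  · rintro (⟨n, rfl⟩ | ⟨n, rfl⟩)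
    · exact ⟨n, by rintro rfl; exact hy (zpow_zero _), Or.inl rfl⟩
    · exact ⟨n, by rintro rfl; exact hx (zpow_zero _), Or.inr rfl⟩

theorem powerGraph_adj_iff {x y : G} :
    (powerGraph G).Adj x y ↔
      x ≠ y ∧ (y ∈ Subgroup.zpowers x ∨ x ∈ Subgroup.zpowers y) := by
  refine and_congr_right fun _ => ⟨?_, ?_⟩
  · rintro ⟨n, h | h⟩
    · exact Or.inl ⟨n, h.symm⟩
    · exact Or.inr ⟨n, h.symm⟩
  · rintro (⟨n, rfl⟩ | ⟨n, rfl⟩)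
    · exact ⟨n, Or.inl rfl⟩
    · exact ⟨n, Or.inr rfl⟩

theorem ratComparable_iff_mem_zpowers (a b : ℚ) :
    (Multiplicative.ofAdd b ∈ Subgroup.zpowers (Multiplicative.ofAdd a) ∨
      Multiplicative.ofAdd a ∈ Subgroup.zpowers (Multiplicative.ofAdd b)) ↔
      RatComparable a b := by
  have key : ∀ a b : ℚ, Multiplicative.ofAdd b ∈ Subgroup.zpowers (Multiplicative.ofAdd a) ↔
      ∃ n : ℤ, b = n * a := by
    intro a b
    rw [Subgroup.mem_zpowers_iff]
    refine exists_congr fun n => ?_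
    rw [← ofAdd_zsmul, Multiplicative.ofAdd.injective.eq_iff, zsmul_eq_mul, eq_comm]
  rw [key, key, ← exists_or]
  rfl

/-- Graphs that agree with the power graphs away from the identity elements are treated together:
only adjacency of nontrivial elements matters once `0` corresponds to `1`. -/
theorem preservesComparability_of_iso {Γ : SimpleGraph G} {Δ : SimpleGraph (Multiplicative ℚ)}
    (hΓ : ∀ x y : G, x ≠ 1 → y ≠ 1 → (Γ.Adj x y ↔
      x ≠ y ∧ (y ∈ Subgroup.zpowers x ∨ x ∈ Subgroup.zpowers y)))
    (hΔ : ∀ x y : Multiplicative ℚ, x ≠ 1 → y ≠ 1 → (Δ.Adj x y ↔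
      x ≠ y ∧ (y ∈ Subgroup.zpowers x ∨ x ∈ Subgroup.zpowers y)))
    (φ : Γ ≃g Δ) (h1 : φ 1 = 1) :
    PreservesComparability (Multiplicative.ofAdd.trans φ.symm.toEquiv) := by
  have h0 : φ.symm 1 = 1 := by rw [← h1, RelIso.symm_apply_apply]
  refine ⟨h0, fun a b ha hb => ?_⟩
  change (φ.symm (Multiplicative.ofAdd b) ∈ Subgroup.zpowers (φ.symm (Multiplicative.ofAdd a)) ∨
    φ.symm (Multiplicative.ofAdd a) ∈ Subgroup.zpowers (φ.symm (Multiplicative.ofAdd b))) ↔ _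
  rw [← ratComparable_iff_mem_zpowers]
  by_cases hab : a = b
  · subst hab
    simp
  have hne : ∀ c : ℚ, c ≠ 0 → φ.symm (Multiplicative.ofAdd c) ≠ 1 :=
    fun c hc h => hc (φ.symm.injective (h.trans h0.symm))
  have hab' : Multiplicative.ofAdd a ≠ Multiplicative.ofAdd b :=
    fun h => hab (Multiplicative.ofAdd.injective h)
  have e1 := hΓ _ _ (hne a ha) (hne b hb)
  have e2 := hΔ (Multiplicative.ofAdd a) (Multiplicative.ofAdd b) ha hb
  rw [φ.symm.map_adj_iff, e2] at e1
  have hne' := φ.symm.injective.ne hab'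
  tauto

/-- In the `Z^±`-power graph, `1` is adjacent to exactly the nontrivial torsion elements. -/
theorem zpmPowerGraph_one_adj_iff {x : G} :
    (zpmPowerGraph G).Adj 1 x ↔ x ≠ 1 ∧ ∃ n : ℤ, n ≠ 0 ∧ x ^ n = 1 := by
  constructor
  · rintro ⟨hne, n, hn, h | h⟩
    · exact absurd (h.trans (one_zpow n)).symm hne
    · exact ⟨hne.symm, n, hn, h.symm⟩
  · rintro ⟨hne, n, hn, h⟩
    exact ⟨hne.symm, n, hn, Or.inr h.symm⟩

theorem zpmPowerGraph_one_adj_trans {x y : G} (hx : (zpmPowerGraph G).Adj 1 x)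
    (hxy : (zpmPowerGraph G).Adj x y) (hy : y ≠ 1) : (zpmPowerGraph G).Adj 1 y := by
  obtain ⟨-, n, hn, h⟩ := zpmPowerGraph_one_adj_iff.1 hx
  obtain ⟨-, k, hk, rfl | rfl⟩ := hxy
  · exact zpmPowerGraph_one_adj_iff.2 ⟨hy, n, hn, by rw [← zpow_mul, mul_comm, zpow_mul, h,
      one_zpow]⟩
  · exact zpmPowerGraph_one_adj_iff.2 ⟨hy, k * n, mul_ne_zero hk hn, by rw [zpow_mul, h]⟩

theorem zpmPowerGraph_iso_map_one (φ : zpmPowerGraph G ≃g zpmPowerGraph (Multiplicative ℚ)) :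
    φ 1 = 1 := by
  by_contra h
  obtain ⟨q, hq⟩ := Multiplicative.ofAdd.surjective (φ 1)
  have hq0 : q ≠ 0 := by
    rintro rfl
    exact h hq.symm
  have hne : ∀ c : ℚ, c ≠ 0 → Multiplicative.ofAdd c ≠ 1 := fun c hc h => hc h
  have hadj : ∀ a b : ℚ, a ≠ 0 → b ≠ 0 →
      ((zpmPowerGraph (Multiplicative ℚ)).Adj (Multiplicative.ofAdd a) (Multiplicative.ofAdd b) ↔
        a ≠ b ∧ RatComparable a b) := by
    intro a b ha hb
    rw [zpmPowerGraph_adj_iff (hne a ha) (hne b hb), ratComparable_iff_mem_zpowers,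
      Multiplicative.ofAdd.injective.ne_iff]
  have h2 : (2 : ℚ) * q ≠ 0 := by positivity
  have h3 : (2 : ℚ) * q / 3 ≠ 0 := by positivity
  -- The path `q, 2q, 2q/3` has nonadjacent ends.
  have hs : φ.symm (Multiplicative.ofAdd q) = 1 := by rw [hq, RelIso.symm_apply_apply]
  have a1 := (hadj q (2 * q) hq0 h2).2
    ⟨fun h => hq0 (by linarith), ⟨2, Or.inl (by push_cast; rfl)⟩⟩
  have a2 := (hadj (2 * q) (2 * q / 3) h2 h3).2
    ⟨fun h => hq0 (by linarith), ⟨3, Or.inr (by push_cast; ring)⟩⟩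
  rw [← φ.symm.map_adj_iff, hs] at a1
  rw [← φ.symm.map_adj_iff] at a2
  have a3 := zpmPowerGraph_one_adj_trans a1 a2 fun h => by
    have := φ.symm.injective (h.trans hs.symm)
    have := Multiplicative.ofAdd.injective this
    exact hq0 (by linarith)
  rw [← hs, φ.symm.map_adj_iff, hadj _ _ hq0 h3] at a3
  exact not_ratComparable_two_thirds hq0 a3.2

theorem powerGraph_iso_map_one (φ : powerGraph G ≃g powerGraph (Multiplicative ℚ)) :
    φ 1 = 1 := by
  by_contra h
  obtain ⟨q, hq⟩ := Multiplicative.ofAdd.surjective (φ 1)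
  have hq0 : q ≠ 0 := by
    rintro rfl
    exact h hq.symm
  have hs : φ.symm (Multiplicative.ofAdd q) = 1 := by rw [hq, RelIso.symm_apply_apply]
  -- The identity of `G` is adjacent to every other vertex, but `q` is not adjacent to `2q/3`.
  have a : (powerGraph G).Adj 1 (φ.symm (Multiplicative.ofAdd (2 * q / 3))) := by
    refine powerGraph_adj_iff.2 ⟨fun h => ?_, Or.inr (one_mem _)⟩
    have := Multiplicative.ofAdd.injective (φ.symm.injective (hs.trans h))
    exact hq0 (by linarith)
  rw [← hs, φ.symm.map_adj_iff, powerGraph_adj_iff, ratComparable_iff_mem_zpowers] at a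
  exact not_ratComparable_two_thirds hq0 a.2

end Graphs

theorem mainTheorem5 (G : Type*) [Group G] :
    (Nonempty (zpmPowerGraph G ≃g zpmPowerGraph (Multiplicative ℚ)) →
      Nonempty (G ≃* Multiplicative ℚ)) ∧
    (Nonempty (powerGraph G ≃g powerGraph (Multiplicative ℚ)) →
      Nonempty (G ≃* Multiplicative ℚ)) := by
  refine ⟨fun ⟨φ⟩ => ?_, fun ⟨φ⟩ => ?_⟩
  · exact (preservesComparability_of_iso (fun _ _ => zpmPowerGraph_adj_iff)
      (fun _ _ => zpmPowerGraph_adj_iff) φ (zpmPowerGraph_iso_map_one φ)).nonempty_mulEquiv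
  · exact (preservesComparability_of_iso (fun _ _ _ _ => powerGraph_adj_iff)
      (fun _ _ _ _ => powerGraph_adj_iff) φ (powerGraph_iso_map_one φ)).nonempty_mulEquiv
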